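/- Let $K$ be an algebraically closed field and let $\Lambda$ be a finite-dimensional monomial $K$-algebra, that is, a finite-dimensional $K$-algebra isomorphic to a bound quiver algebra $KQ/\langle\rho\rangle$, where $Q$ is a finite quiver and $\rho$ is a set of paths of $Q$ that generates an admissible ideal: $R^m\subseteq\langle\rho\rangle\subseteq R^2$ for some $m\ge 2$, where $R$ is the ideal of $KQ$ generated by the arrows. If $\Lambda$ is self-injective, i.e. the left regular module ${}_\Lambda\Lambda$ is injective, then $\Lambda$ is a Nakayama algebra: every indecomposable projective and every indecomposable injective finite-dimensional left $\Lambda$-module is uniserial, i.e. its submodules are linearly ordered by inclusion. -/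

import Mathlib

noncomputable section

/-- A path of the quiver `V` (of any length, stationary paths included), together with its source
and its target. -/
structure QuiverPath (V : Type*) [Quiver V] where
  src : V
  tgt : V
  path : Quiver.Path src tgt

/-- The path algebra `K Q`: the `K`-vector space with basis the set of all paths of the quiver;
its multiplication is defined below. -/
def PathAlgebra (K V : Type*) [Field K] [Quiver V] : Type _ := QuiverPath V →₀ K

namespace PathAlgebra

section

variable (K : Type*) {V : Type*} [Field K] [Quiver V]

instance : AddCommGroup (PathAlgebra K V) := inferInstanceAs (AddCommGroup (QuiverPath V →₀ K))

instance : Module K (PathAlgebra K V) := inferInstanceAs (Module K (QuiverPath V →₀ K))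

/-- The basis vector of `K Q` given by a path. -/
def of (x : QuiverPath V) : PathAlgebra K V := Finsupp.single x (1 : K)

/-- The `K`-linear map that is prescribed on the basis of paths. -/
def lift {M : Type*} [AddCommGroup M] [Module K M] (f : QuiverPath V → M) :
    PathAlgebra K V →ₗ[K] M :=
  Finsupp.lift M K (QuiverPath V) f

open Classical in
/-- The product `x y` of two paths, written as composition of maps: first `y`, then `x`. It is the
concatenated path if `y` ends where `x` starts, and `0` otherwise. -/
def pathMul (x y : QuiverPath V) : PathAlgebra K V :=
  if h : y.tgt = x.src then of K ⟨y.src, x.tgt, (y.path.cast rfl h).comp x.path⟩ else 0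

variable (V) in
/-- The multiplication of `K Q`: the `K`-bilinear extension of the product of paths. -/
def mulLin : PathAlgebra K V →ₗ[K] PathAlgebra K V →ₗ[K] PathAlgebra K V :=
  lift K fun x => lift K fun y => pathMul K x y

end

section

variable {K V : Type*} [Field K] [Quiver V]

theorem lift_of {M : Type*} [AddCommGroup M] [Module K M] (f : QuiverPath V → M)
    (x : QuiverPath V) : lift K f (of K x) = f x :=
  (Finsupp.sum_single_index (h := fun y r => r • f y) (zero_smul K _)).trans (one_smul K _)

theorem mulLin_of (x y : QuiverPath V) : mulLin K V (of K x) (of K y) = pathMul K x y := by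
  rw [mulLin, lift_of, lift_of]

theorem hom_ext {M : Type*} [AddCommGroup M] [Module K M] {f g : PathAlgebra K V →ₗ[K] M}
    (h : ∀ x, f (of K x) = g (of K x)) : f = g :=
  Finsupp.lhom_ext' fun x => LinearMap.ext_ring (h x)

theorem pathMul_assoc (x y z : QuiverPath V) :
    mulLin K V (pathMul K x y) (of K z) = mulLin K V (of K x) (pathMul K y z) := by
  obtain ⟨xs, xt, x⟩ := x
  obtain ⟨ys, yt, y⟩ := y
  obtain ⟨zs, zt, z⟩ := z
  by_cases h₁ : yt = xs <;> by_cases h₂ : zt = ys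
  · subst h₁ h₂
    simp [pathMul, mulLin_of]
  · subst h₁
    simp [pathMul, mulLin_of, h₂]
  · subst h₂
    simp [pathMul, mulLin_of, h₁]
  · simp [pathMul, h₁, h₂]

theorem mulLin_assoc (a b c : PathAlgebra K V) :
    mulLin K V (mulLin K V a b) c = mulLin K V a (mulLin K V b c) := by
  have h₁ (x y : QuiverPath V) :
      mulLin K V (pathMul K x y) = mulLin K V (of K x) ∘ₗ mulLin K V (of K y) :=
    hom_ext fun z => by simpa [mulLin_of] using pathMul_assoc x y z
  have h₂ (x : QuiverPath V) : (mulLin K V).flip c ∘ₗ mulLin K V (of K x) =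
      mulLin K V (of K x) ∘ₗ (mulLin K V).flip c :=
    hom_ext fun y => by simpa [mulLin_of] using congr($(h₁ x y) c)
  have h₃ : (mulLin K V).flip c ∘ₗ (mulLin K V).flip b =
      (mulLin K V).flip (mulLin K V b c) :=
    hom_ext fun x => by simpa using congr($(h₂ x) b)
  simpa using congr($h₃ a)

variable [Fintype V]

variable (K V) in
/-- The unit of `K Q` for finitely many vertices: the sum of all stationary paths. -/
def unit : PathAlgebra K V := ∑ i : V, of K ⟨i, i, Quiver.Path.nil⟩

theorem unit_mulLin (a : PathAlgebra K V) : mulLin K V (unit K V) a = a := by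
  have h : mulLin K V (unit K V) = LinearMap.id := by
    refine hom_ext fun x => ?_
    rw [unit, map_sum, LinearMap.sum_apply, Finset.sum_eq_single x.tgt]
    · simp [mulLin_of, pathMul]
    · intro i _ hi
      simp [mulLin_of, pathMul, hi.symm]
    · simp
  simpa using congr($h a)

theorem mulLin_unit (a : PathAlgebra K V) : mulLin K V a (unit K V) = a := by
  have h : (mulLin K V).flip (unit K V) = LinearMap.id := by
    refine hom_ext fun x => ?_
    rw [LinearMap.flip_apply, unit, map_sum, Finset.sum_eq_single x.src]
    · simp [mulLin_of, pathMul]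
    · intro i _ hi
      simp [mulLin_of, pathMul, hi]
    · simp
  simpa using congr($h a)

instance : Ring (PathAlgebra K V) where
  __ := (inferInstance : AddCommGroup (PathAlgebra K V))
  mul a b := mulLin K V a b
  one := unit K V
  left_distrib a b c := map_add (mulLin K V a) b c
  right_distrib a b c := LinearMap.map_add₂ (mulLin K V) a b c
  zero_mul a := LinearMap.map_zero₂ (mulLin K V) a
  mul_zero a := map_zero (mulLin K V a)
  mul_assoc := mulLin_assoc
  one_mul := unit_mulLin
  mul_one := mulLin_unit

instance : Algebra K (PathAlgebra K V) :=
  Algebra.ofModule (fun r a b => LinearMap.map_smul₂ (mulLin K V) r a b)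
    (fun r a b => map_smul (mulLin K V a) r b)

end

end PathAlgebra

section

variable (K V : Type*) [Field K] [Fintype V] [Quiver V]

/-- The two-sided ideal of `K Q` generated by a set of paths. -/
def monomialIdeal {V : Type*} [Fintype V] [Quiver V] (ρ : Set (QuiverPath V)) :
    Ideal (PathAlgebra K V) :=
  (TwoSidedIdeal.span (PathAlgebra.of K '' ρ)).asIdeal

instance {V : Type*} [Fintype V] [Quiver V] (ρ : Set (QuiverPath V)) :
    (monomialIdeal K ρ).IsTwoSided :=
  inferInstanceAs (TwoSidedIdeal.span (PathAlgebra.of K '' ρ)).asIdeal.IsTwoSided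

/-- The arrow ideal of `K Q`: the two-sided ideal generated by all arrows. -/
def arrowIdeal : Ideal (PathAlgebra K V) :=
  monomialIdeal K {x : QuiverPath V | x.path.length = 1}

/-- An ideal `I` of `K Q` is admissible if `R ^ m ⊆ I ⊆ R ^ 2` for the arrow ideal `R` and some
`m ≥ 2`. -/
def IsAdmissible {K V : Type*} [Field K] [Fintype V] [Quiver V]
    (I : Ideal (PathAlgebra K V)) : Prop :=
  (∃ m : ℕ, 2 ≤ m ∧ arrowIdeal K V ^ m ≤ I) ∧ I ≤ arrowIdeal K V ^ 2

end

/-- `A` is a monomial `K`-algebra: it is isomorphic to a bound quiver algebra `K Q / ⟨ρ⟩` of a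
finite quiver `Q`, where `ρ` is a set of paths that generates an admissible ideal. The quiver has
finitely many vertices and arrows, so that it is no restriction to take these in `Type`. -/
def IsMonomialAlgebra (K A : Type*) [Field K] [Ring A] [Algebra K A] : Prop :=
  ∃ (V : Type) (_ : Fintype V) (_ : Quiver.{0} V) (_ : ∀ i j : V, Finite (i ⟶ j))
    (ρ : Set (QuiverPath V)),
    IsAdmissible (monomialIdeal K ρ) ∧ Nonempty (A ≃ₐ[K] (PathAlgebra K V ⧸ monomialIdeal K ρ))

/-- A ring is (left) self-injective if its left regular module is injective. -/
def IsSelfInjective (A : Type*) [Ring A] : Prop := Module.Injective A A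

/-- A module is indecomposable if it is nonzero and not the direct sum of two nonzero
submodules. -/
def IsIndecomposableModule (A M : Type*) [Ring A] [AddCommGroup M] [Module A M] : Prop :=
  Nontrivial M ∧ ∀ N P : Submodule A M, IsCompl N P → N = ⊥ ∨ P = ⊥

/-- A module is uniserial if its submodules are linearly ordered by inclusion. -/
def IsUniserialModule (A M : Type*) [Ring A] [AddCommGroup M] [Module A M] : Prop :=
  ∀ N P : Submodule A M, N ≤ P ∨ P ≤ N

/-- The finite-dimensional algebra `A` is a Nakayama algebra: all its finitely generated
indecomposable projective modules and all its finitely generated indecomposable injective modules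
are uniserial. Every finitely generated `A`-module has an isomorphic copy in the universe of `A`. -/
def IsNakayamaAlgebra.{u} (A : Type u) [Ring A] : Prop :=
  (∀ (P : Type u) [AddCommGroup P] [Module A P], Module.Finite A P →
    IsIndecomposableModule A P → Module.Projective A P → IsUniserialModule A P) ∧
  (∀ (E : Type u) [AddCommGroup E] [Module A E], Module.Finite A E →
    IsIndecomposableModule A E → Module.Injective A E → IsUniserialModule A E)

end

/-! The kernel of `K Q → A` is spanned by paths, so the nonzero paths form a basis of `A`, and a
maximal nonzero path spans a simple left ideal whose type is given by its target. Endomorphisms of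
the left module `A` are right multiplications, so self-injectivity becomes a statement about
products of paths. Maximal paths with the same target are right multiples of each other, hence equal
(`IsMaximalPath.eq_of_tgt_eq`). Distinct maximal paths with the same source could be separated by a
right multiplication, which their coefficients forbid (`IsMaximalPath.eq_of_src_eq`). So the nonzero
paths starting at `i` are the initial segments of a single one, every nonzero element of `A e_i` is
a unit times a path (`exists_isUnit_mul_eq`), and `A e_i` is uniserial.

Sending a vertex to the target of its maximal path is injective, hence a permutation, so every
simple module occurs in the socle of some `A e_j`. An indecomposable injective `E` is uniform by
Fitting's lemma and therefore embeds in such an `A e_j`. Finitely generated projectives are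
injective, so this case covers them too. -/

noncomputable section

universe u

/-! ### Coefficients and monomial ideals in the path algebra. -/

namespace PathAlgebra

variable {K V : Type*} [Field K] [Quiver V]

/-- The coefficient of an element of `K Q` at a path. -/
def coeff (q : QuiverPath V) : PathAlgebra K V →ₗ[K] K :=
  Finsupp.lapply q

open Classical in
theorem coeff_of (p q : QuiverPath V) : coeff q (of K p) = if p = q then 1 else 0 :=
  Finsupp.single_apply

@[simp]
theorem coeff_of_self (p : QuiverPath V) : coeff p (of K p) = 1 := by
  simp [coeff_of]

theorem coeff_of_ne {p q : QuiverPath V} (h : p ≠ q) : coeff q (of K p) = 0 := by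
  simp [coeff_of, h]

theorem ext_coeff {x y : PathAlgebra K V} (h : ∀ q, coeff q x = coeff q y) : x = y :=
  Finsupp.ext h

theorem mem_of_coeff (S : Submodule K (PathAlgebra K V)) (x : PathAlgebra K V)
    (h : ∀ q, coeff q x ≠ 0 → of K q ∈ S) : x ∈ S := by
  have hx : x = Finsupp.sum x fun q c => c • of K q := by
    refine (Finsupp.sum_single x).symm.trans (Finset.sum_congr rfl fun q _ => ?_)
    exact ((Finsupp.smul_single _ _ _).trans (by rw [smul_eq_mul, mul_one])).symm
  rw [hx]
  exact S.sum_mem fun q hq => S.smul_mem _ (h q (Finsupp.mem_support_iff.1 hq))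

theorem exists_min_length {x : PathAlgebra K V} (hx : x ≠ 0) :
    ∃ p, coeff p x ≠ 0 ∧ ∀ q, coeff q x ≠ 0 → p.path.length ≤ q.path.length := by
  have hne : {q | coeff q x ≠ 0}.Nonempty := by
    by_contra! h
    exact hx (ext_coeff fun q => by simpa using congr(q ∈ $h))
  obtain ⟨p, hp, hmin⟩ := exists_minimalFor_of_wellFoundedLT
    (fun q => coeff q x ≠ 0) (fun q : QuiverPath V => q.path.length) hne
  refine ⟨p, hp, fun q hq => ?_⟩
  by_contra! h
  exact absurd (hmin hq h.le) (by simpa using h)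

variable [Fintype V]

theorem of_mul_of_comp {a b c : V} (p : Quiver.Path a b) (q : Quiver.Path b c) :
    of K ⟨b, c, q⟩ * of K ⟨a, b, p⟩ = of K ⟨a, c, p.comp q⟩ :=
  (mulLin_of _ _).trans (by simp [pathMul])

theorem of_mul_of_ne {x y : QuiverPath V} (h : y.tgt ≠ x.src) : of K x * of K y = 0 :=
  (mulLin_of _ _).trans (by simp [pathMul, h])

theorem one_eq_sum : (1 : PathAlgebra K V) = ∑ i : V, of K ⟨i, i, Quiver.Path.nil⟩ := rfl

/-- A set of paths closed under prolongation at both ends spans a two-sided ideal, which therefore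
contains the ideal generated by `ρ`. -/
theorem coeff_of_mem_monomialIdeal {ρ Z : Set (QuiverPath V)} (hρ : ρ ⊆ Z)
    (hl : ∀ {a b c : V} (p : Quiver.Path a b) (q : Quiver.Path b c),
      (⟨a, b, p⟩ : QuiverPath V) ∈ Z → (⟨a, c, p.comp q⟩ : QuiverPath V) ∈ Z)
    (hr : ∀ {a b c : V} (p : Quiver.Path a b) (q : Quiver.Path b c),
      (⟨b, c, q⟩ : QuiverPath V) ∈ Z → (⟨a, c, p.comp q⟩ : QuiverPath V) ∈ Z)
    {x : PathAlgebra K V} (hx : x ∈ monomialIdeal K ρ) {q : QuiverPath V} (hq : coeff q x ≠ 0) :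
    q ∈ Z := by
  let S : Submodule K (PathAlgebra K V) := Submodule.span K (of K '' Z)
  have hS (p : QuiverPath V) (hp : p ∈ Z) : of K p ∈ S := Submodule.subset_span ⟨p, hp, rfl⟩
  have hcoeff (y : PathAlgebra K V) (hy : y ∈ S) (p : QuiverPath V) (hp : coeff p y ≠ 0) :
      p ∈ Z := by
    by_contra hpZ
    have : S ≤ LinearMap.ker (coeff p) := by
      refine Submodule.span_le.2 ?_
      rintro _ ⟨r, hr, rfl⟩
      exact coeff_of_ne fun h => hpZ (h ▸ hr)
    exact hp (this hy)
  have hmul (p r : QuiverPath V) (h : p ∈ Z ∨ r ∈ Z) : of K p * of K r ∈ S := by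
    obtain ⟨b, c, p⟩ := p
    obtain ⟨a, b', r⟩ := r
    by_cases hb : b' = b
    · subst hb
      rw [of_mul_of_comp]
      exact hS _ (h.elim (hr r p) (hl r p))
    · rw [of_mul_of_ne hb]
      exact S.zero_mem
  let J : TwoSidedIdeal (PathAlgebra K V) := TwoSidedIdeal.mk' S S.zero_mem S.add_mem S.neg_mem
    -- Bilinearity: the two uses of `mem_of_coeff` reduce to a product of two paths, one of them in
    -- `Z`.
    (fun {y z} hz => mem_of_coeff (S.comap ((mulLin K V).flip z)) y fun p _ =>
      mem_of_coeff (S.comap (mulLin K V (of K p))) z fun r hr => hmul p r (.inr (hcoeff z hz r hr)))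
    (fun {y z} hy => mem_of_coeff (S.comap ((mulLin K V).flip z)) y fun p hp =>
      mem_of_coeff (S.comap (mulLin K V (of K p))) z fun r _ => hmul p r (.inl (hcoeff y hy p hp)))
  have hJ : TwoSidedIdeal.span (of K '' ρ) ≤ J := by
    refine TwoSidedIdeal.span_le.2 ?_
    rintro _ ⟨p, hp, rfl⟩
    exact (TwoSidedIdeal.mem_mk' ..).2 (hS p (hρ hp))
  exact hcoeff x ((TwoSidedIdeal.mem_mk' ..).1 (hJ (TwoSidedIdeal.mem_asIdeal.1 hx))) q hq

theorem of_mem_monomialIdeal {ρ : Set (QuiverPath V)} {p : QuiverPath V} (hp : p ∈ ρ) :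
    of K p ∈ monomialIdeal K ρ :=
  TwoSidedIdeal.mem_asIdeal.2 (TwoSidedIdeal.subset_span ⟨p, hp, rfl⟩)

theorem of_mem_of_coeff_mem_monomialIdeal {ρ : Set (QuiverPath V)} {x : PathAlgebra K V}
    (hx : x ∈ monomialIdeal K ρ) {q : QuiverPath V} (hq : coeff q x ≠ 0) :
    of K q ∈ monomialIdeal K ρ := by
  refine coeff_of_mem_monomialIdeal (Z := {q | of K q ∈ monomialIdeal K ρ})
    (fun p hp => of_mem_monomialIdeal hp) (fun p q h => ?_) (fun p q h => ?_) hx hq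
  · rw [Set.mem_ofPred_eq, ← of_mul_of_comp]
    exact Ideal.mul_mem_left _ _ h
  · rw [Set.mem_ofPred_eq, ← of_mul_of_comp]
    exact Ideal.mul_mem_right _ _ h

instance : (arrowIdeal K V).IsTwoSided :=
  inferInstanceAs (monomialIdeal K {x : QuiverPath V | x.path.length = 1}).IsTwoSided

theorem length_pos_of_mem_arrowIdeal {x : PathAlgebra K V} (hx : x ∈ arrowIdeal K V)
    {q : QuiverPath V} (hq : coeff q x ≠ 0) : 0 < q.path.length := by
  refine coeff_of_mem_monomialIdeal (Z := {q | 0 < q.path.length})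
    (fun p hp => ?_) (fun p q h => ?_) (fun p q h => ?_) hx hq
  · rw [Set.mem_ofPred_eq] at hp ⊢
    omega
  all_goals
    simp only [Set.mem_ofPred_eq, Quiver.Path.length_comp] at h ⊢
    omega

theorem of_mem_arrowIdeal_pow {a b : V} (p : Quiver.Path a b) :
    of K ⟨a, b, p⟩ ∈ arrowIdeal K V ^ p.length := by
  induction p with
  | nil => rw [Quiver.Path.length_nil, Submodule.pow_zero, Ideal.one_eq_top]; trivial
  | cons p e ih =>
    have he : of K ⟨_, _, e.toPath⟩ ∈ arrowIdeal K V := of_mem_monomialIdeal rfl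
    rw [Quiver.Path.length_cons, ← Quiver.Path.comp_toPath_eq_cons, ← of_mul_of_comp]
    rcases eq_or_ne p.length 0 with h | h
    · rw [h, Submodule.pow_one]
      exact Ideal.mul_mem_right _ _ he
    · rw [Submodule.pow_succ' _ h]
      exact Ideal.mul_mem_mul he ih

theorem of_mem_arrowIdeal_pow_of_le {m : ℕ} {a b : V} (p : Quiver.Path a b) (h : m ≤ p.length) :
    of K ⟨a, b, p⟩ ∈ arrowIdeal K V ^ m := by
  induction p with
  | nil =>
    obtain rfl := Nat.le_zero.1 h
    exact of_mem_arrowIdeal_pow (Quiver.Path.nil (a := a))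
  | cons p e ih =>
    rcases h.lt_or_eq with h | rfl
    · rw [← Quiver.Path.comp_toPath_eq_cons, ← of_mul_of_comp]
      exact Ideal.mul_mem_left _ _ (ih (Nat.le_of_lt_succ h))
    · exact of_mem_arrowIdeal_pow _

theorem mem_arrowIdeal_of_coeff {x : PathAlgebra K V}
    (h : ∀ q, coeff q x ≠ 0 → 0 < q.path.length) : x ∈ arrowIdeal K V := by
  refine mem_of_coeff ((arrowIdeal K V).restrictScalars K) x fun q hq => ?_
  simpa [Submodule.pow_one] using of_mem_arrowIdeal_pow_of_le (K := K) (m := 1) q.path (h q hq)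

/-- Every path occurring in `m * y` is at least as long as `m`, with equality only for `m`. -/
theorem coeff_of_mul {a b : V} (m : Quiver.Path a b) (y : PathAlgebra K V) (z : QuiverPath V)
    (hz : coeff z (of K ⟨a, b, m⟩ * y) ≠ 0) : m.length ≤ z.path.length ∧
      (z.path.length ≤ m.length → z = ⟨a, b, m⟩) := by
  by_contra hcon
  refine hz (mem_of_coeff (LinearMap.ker (coeff z ∘ₗ mulLin K V (of K ⟨a, b, m⟩))) y
    fun q _ => ?_)
  change coeff z (of K ⟨a, b, m⟩ * of K q) = 0
  obtain ⟨c, a', q⟩ := q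
  by_cases h : a' = a
  · subst h
    rw [of_mul_of_comp]
    refine coeff_of_ne fun h => hcon ?_
    subst h
    refine ⟨by simp, fun hle => ?_⟩
    simp only [Quiver.Path.length_comp] at hle
    cases q with
    | nil => simp
    | cons q e => simp at hle
  · rw [of_mul_of_ne h, map_zero]

/-- Only the stationary path at `a`, followed by `m`, gives `m` again. -/
theorem coeff_self_of_mul {a b : V} (m : Quiver.Path a b) (y : PathAlgebra K V) :
    coeff ⟨a, b, m⟩ (of K ⟨a, b, m⟩ * y) = coeff ⟨a, a, .nil⟩ y := by
  refine mem_of_coeff (LinearMap.eqLocus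
    (coeff ⟨a, b, m⟩ ∘ₗ mulLin K V (of K ⟨a, b, m⟩)) (coeff ⟨a, a, .nil⟩)) y fun q _ => ?_
  change coeff _ (of K ⟨a, b, m⟩ * of K q) = _
  obtain ⟨c, a', q⟩ := q
  by_cases h : a' = a
  · subst h
    rw [of_mul_of_comp]
    cases q with
    | nil => simp
    | cons q e =>
      rw [coeff_of_ne, coeff_of_ne]
      · intro h
        have := congr(($h).path.length)
        simp at this
      · intro h
        have := congr(($h).path.length)
        simp at this
  · rw [of_mul_of_ne h, map_zero, coeff_of_ne]
    intro h'
    exact h congr(($h').tgt)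

end PathAlgebra

/-- Initial segments of one path are comparable: strip common last arrows until the remainder of the
longer segment is used up. -/
theorem Quiver.Path.exists_eq_comp_of_comp_eq_comp {V : Type*} [Quiver V] {a b c d : V}
    (p : Quiver.Path a b) (r : Quiver.Path b d) (q : Quiver.Path a c) (r' : Quiver.Path c d)
    (h : p.comp r = q.comp r') (hle : p.length ≤ q.length) :
    ∃ t : Quiver.Path b c, q = p.comp t := by
  induction r' with
  | nil => exact ⟨r, h.symm⟩
  | cons r' e ih =>
    cases r with
    | nil =>
      have := congr(($h).length)
      simp at this
      omega
    | cons r e' =>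
      rw [comp_cons, comp_cons] at h
      have hb := obj_eq_of_cons_eq_cons h
      subst hb
      exact ih r (eq_of_heq (heq_of_cons_eq_cons h))

/-! ### Extension properties of injective modules. -/

section InjectiveModules

variable {A : Type*} [Ring A] {M : Type u} [AddCommGroup M] [Module A M]

/-- The projection `N ⊕ P → N ⊆ M` extends along the embedding `N ⊕ P → M`. -/
theorem Module.Injective.exists_projection (hM : Module.Injective A M) {N P : Submodule A M}
    (h : Disjoint N P) :
    ∃ f : M →ₗ[A] M, (∀ x ∈ N, f x = x) ∧ ∀ x ∈ P, f x = 0 := by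
  have hinj : Function.Injective (N.subtype.coprod P.subtype) := by
    rw [← LinearMap.ker_eq_bot, LinearMap.ker_coprod_of_disjoint_range]
    · simp
    · simpa using h
  obtain ⟨f, hf⟩ := hM.out _ hinj (N.subtype ∘ₗ LinearMap.fst A N P)
  exact ⟨f, fun x hx => by simpa using hf (⟨x, hx⟩, 0), fun x hx => by simpa using hf (0, ⟨x, hx⟩)⟩

/-- The annihilator condition makes `a • x ↦ a • y` well defined on the cyclic submodule of `x`;
injectivity extends it. -/
theorem Module.Injective.exists_map_eq (hM : Module.Injective A M) {N : Type u} [AddCommGroup N]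
    [Module A N] (x : N) (y : M) (h : ∀ a : A, a • x = 0 → a • y = 0) :
    ∃ f : N →ₗ[A] M, f x = y := by
  have hle : LinearMap.ker (LinearMap.toSpanSingleton A N x) ≤
      LinearMap.ker (LinearMap.toSpanSingleton A M y) := fun a ha => h a ha
  let e := (LinearMap.toSpanSingleton A N x).quotKerEquivRange
  let g := (LinearMap.ker (LinearMap.toSpanSingleton A N x)).liftQ _ hle ∘ₗ e.symm.toLinearMap
  obtain ⟨f, hf⟩ := hM.out (LinearMap.range (LinearMap.toSpanSingleton A N x)).subtype
    (Submodule.subtype_injective _) g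
  refine ⟨f, ?_⟩
  have := hf ⟨x, 1, by simp⟩
  have he : e.symm ⟨x, 1, by simp⟩ = Submodule.Quotient.mk 1 := by
    rw [LinearEquiv.symm_apply_eq]
    ext
    simp [e]
  simpa [g, he] using this

/-- Such a module is a direct summand of some `A ^ n`. -/
theorem Module.Injective.of_projective {A P : Type u} [Ring A] [AddCommGroup P] [Module A P]
    [Module.Injective A A] [Module.Finite A P] [Module.Projective A P] : Module.Injective A P := by
  obtain ⟨n, f, hf⟩ := Module.Finite.exists_fin' A P
  obtain ⟨s, hs⟩ := Module.projective_lifting_property f LinearMap.id hf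
  refine ⟨fun X Y _ _ _ _ i hi g => ?_⟩
  obtain ⟨h, hh⟩ := Module.Injective.out (Q := Fin n → A) i hi (s ∘ₗ g)
  exact ⟨f ∘ₗ h, fun x => by simpa [hh] using congr($hs (g x))⟩

/-- Fitting's lemma makes an indecomposable injective module of finite length uniform. -/
theorem IsIndecomposableModule.eq_bot_or_eq_bot [IsArtinian A M] [IsNoetherian A M]
    (hind : IsIndecomposableModule A M) (hM : Module.Injective A M) {N P : Submodule A M}
    (h : Disjoint N P) : N = ⊥ ∨ P = ⊥ := by
  obtain ⟨f, hN, hP⟩ := hM.exists_projection h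
  obtain ⟨n, hn, hc⟩ := ((Filter.eventually_gt_atTop 0).and
    (LinearMap.eventually_isCompl_ker_pow_range_pow f)).exists
  -- As `n > 0`, the map `f ^ n` kills `P`, and it fixes `N`: a zero kernel forces `P = ⊥`, a zero
  -- range forces `N = ⊥`.
  rcases hind.2 _ _ hc with h0 | h0
  · refine .inr (eq_bot_iff.2 fun x hx => ?_)
    rw [← h0, LinearMap.mem_ker]
    obtain ⟨k, rfl⟩ := Nat.exists_eq_add_of_lt hn
    simp [pow_succ, hP x hx]
  · refine .inl (eq_bot_iff.2 fun x hx => ?_)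
    rw [← h0]
    refine ⟨x, ?_⟩
    clear hn hc h0
    induction n with
    | zero => simp
    | succ k ih => simp [pow_succ, hN x hx, ih]

end InjectiveModules

/-! ### Monomial presentations. -/

open PathAlgebra

/-- A surjection from the path algebra onto `A` whose kernel is spanned by paths, contains no
stationary path and contains a power of the arrow ideal. -/
structure MonomialPresentation (K V A : Type*) [Field K] [Fintype V] [Quiver V] [Ring A]
    [Algebra K A] where
  toAlgHom : PathAlgebra K V →ₐ[K] A
  surjective : Function.Surjective toAlgHom
  map_of_eq_zero : ∀ x, toAlgHom x = 0 → ∀ q, coeff q x ≠ 0 → toAlgHom (of K q) = 0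
  map_nil_ne_zero : ∀ i : V, toAlgHom (of K ⟨i, i, .nil⟩) ≠ 0
  bound : ℕ
  map_pow_eq_zero : ∀ x ∈ arrowIdeal K V ^ bound, toAlgHom x = 0

/-- The inclusion in `R ^ 2` is needed only through `R`: it keeps the stationary paths nonzero. -/
theorem IsMonomialAlgebra.exists_presentation {K A : Type*} [Field K] [Ring A] [Algebra K A]
    (h : IsMonomialAlgebra K A) : ∃ (V : Type) (_ : Fintype V) (_ : Quiver.{0} V),
      Nonempty (MonomialPresentation K V A) := by
  obtain ⟨V, _, _, _, ρ, ⟨⟨m, _, hm⟩, hle⟩, ⟨e⟩⟩ := h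
  have hmem (x : PathAlgebra K V) :
      e.symm (Ideal.Quotient.mk (monomialIdeal K ρ) x) = 0 ↔ x ∈ monomialIdeal K ρ := by
    rw [map_eq_zero_iff _ e.symm.injective, Ideal.Quotient.eq_zero_iff_mem]
  refine ⟨V, _, _, ⟨⟨e.symm.toAlgHom.comp (Ideal.Quotient.mkₐ K (monomialIdeal K ρ)),
    e.symm.surjective.comp (Ideal.Quotient.mk_surjective), fun x hx q hq => ?_, fun i hi => ?_, m,
    fun x hx => (hmem x).2 (hm hx)⟩⟩⟩
  · exact (hmem _).2 (of_mem_of_coeff_mem_monomialIdeal ((hmem x).1 hx) hq)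
  · have h2 : of K ⟨i, i, .nil⟩ ∈ arrowIdeal K V := by
      have := hle ((hmem _).1 hi)
      rw [Submodule.pow_succ] at this
      exact Ideal.mul_le_right this
    simpa using length_pos_of_mem_arrowIdeal h2 (q := ⟨i, i, .nil⟩) (by simp)

namespace MonomialPresentation

variable {K V A : Type*} [Field K] [Fintype V] [Quiver V] [Ring A] [Algebra K A]
  (π : MonomialPresentation K V A)

/-- The element of `A` given by a path. -/
def ofPath {a b : V} (p : Quiver.Path a b) : A := π.toAlgHom (of K ⟨a, b, p⟩)

theorem ofPath_mul_ofPath {a b c : V} (q : Quiver.Path b c) (p : Quiver.Path a b) :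
    π.ofPath q * π.ofPath p = π.ofPath (p.comp q) := by
  rw [ofPath, ofPath, ← map_mul, of_mul_of_comp, ofPath]

theorem ofPath_mul_ofPath_of_ne {a b c d : V} (q : Quiver.Path c d) (p : Quiver.Path a b)
    (h : b ≠ c) : π.ofPath q * π.ofPath p = 0 := by
  rw [ofPath, ofPath, ← map_mul, of_mul_of_ne h, map_zero]

/-- Linear independence of the nonzero paths: their coefficients depend only on the image in `A`. -/
theorem coeff_eq_coeff {x y : PathAlgebra K V} (h : π.toAlgHom x = π.toAlgHom y) {a b : V}
    {p : Quiver.Path a b} (hp : π.ofPath p ≠ 0) : coeff ⟨a, b, p⟩ x = coeff ⟨a, b, p⟩ y := by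
  by_contra hne
  exact hp (π.map_of_eq_zero (x - y) (by rw [map_sub, h, sub_self]) ⟨a, b, p⟩
    (by rwa [map_sub, sub_ne_zero]))

theorem ofPath_eq_zero_of_le {a b : V} (p : Quiver.Path a b) (h : π.bound ≤ p.length) :
    π.ofPath p = 0 :=
  π.map_pow_eq_zero _ (of_mem_arrowIdeal_pow_of_le p h)

theorem length_lt_bound {a b : V} {p : Quiver.Path a b} (h : π.ofPath p ≠ 0) :
    p.length < π.bound := by
  by_contra! hle
  exact h (π.ofPath_eq_zero_of_le p hle)

theorem isNilpotent {x : PathAlgebra K V} (h : ∀ q, coeff q x ≠ 0 → 0 < q.path.length) :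
    IsNilpotent (π.toAlgHom x) :=
  ⟨π.bound, by
    rw [← map_pow]
    exact π.map_pow_eq_zero _ (Ideal.pow_mem_pow (mem_arrowIdeal_of_coeff h) _)⟩

theorem isUnit {x : PathAlgebra K V} {c : K} (hc : c ≠ 0)
    (h : ∀ q, coeff q x ≠ 0 → 0 < q.path.length) :
    IsUnit (algebraMap K A c + π.toAlgHom x) :=
  (π.isNilpotent h).isUnit_add_left_of_commute ((IsUnit.mk0 c hc).map (algebraMap K A))
    (Algebra.commute_algebraMap_right c _)

/-! ### Socle elements. -/

/-- An element of a module that is fixed by the idempotent of the vertex `i` and annihilated by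
all arrows. -/
structure IsSocleAt {M : Type*} [AddCommGroup M] [Module A M] (i : V) (s : M) : Prop where
  nil_smul : π.ofPath (Quiver.Path.nil : Quiver.Path i i) • s = s
  arrow_smul : ∀ {j : V} (e : i ⟶ j), π.ofPath e.toPath • s = 0

section Socle

variable {M : Type*} [AddCommGroup M] [Module A M]

theorem ofPath_smul_of_ne {i j k : V} {s : M}
    (h : π.ofPath (Quiver.Path.nil : Quiver.Path i i) • s = s) (p : Quiver.Path j k)
    (hij : i ≠ j) : π.ofPath p • s = 0 := by
  rw [← h, ← mul_smul, π.ofPath_mul_ofPath_of_ne _ _ hij, zero_smul]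

variable {π}

theorem IsSocleAt.ofPath_smul {i j : V} {s : M} (hs : π.IsSocleAt i s) (p : Quiver.Path i j)
    (hp : 0 < p.length) : π.ofPath p • s = 0 := by
  induction p with
  | nil => simp at hp
  | cons p e ih =>
    cases p with
    | nil => exact hs.arrow_smul e
    | cons p e' =>
      rw [← Quiver.Path.comp_toPath_eq_cons, ← ofPath_mul_ofPath, mul_smul, ih (by simp), smul_zero]

/-- All paths other than the stationary one at `i` kill `s`. In particular the annihilator of a
nonzero `s` depends only on `i`. -/
theorem IsSocleAt.smul_eq [Module K M] [IsScalarTower K A M] {i : V} {s : M}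
    (hs : π.IsSocleAt i s) (x : PathAlgebra K V) :
    π.toAlgHom x • s = coeff ⟨i, i, .nil⟩ x • s := by
  refine mem_of_coeff (LinearMap.eqLocus
    ((LinearMap.toSpanSingleton A M s).restrictScalars K ∘ₗ π.toAlgHom.toLinearMap)
    ((LinearMap.toSpanSingleton K M s) ∘ₗ coeff ⟨i, i, .nil⟩)) x fun q _ => ?_
  change π.toAlgHom (of K q) • s = coeff _ (of K q) • s
  obtain ⟨a, b, p⟩ := q
  change π.ofPath p • s = _
  by_cases h : i = a
  · subst h
    cases p with
    | nil => rw [coeff_of_self, one_smul, hs.nil_smul]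
    | cons p e =>
      rw [hs.ofPath_smul _ (by simp), coeff_of_ne, zero_smul]
      intro h
      simpa using congr(($h).path.length)
  · rw [π.ofPath_smul_of_ne hs.nil_smul p h, coeff_of_ne, zero_smul]
    rintro h'
    exact h congr(($h').src).symm

variable (π) in
theorem exists_isSocleAt [Nontrivial M] : ∃ (i : V) (s : M), s ≠ 0 ∧ π.IsSocleAt i s := by
  obtain ⟨s, hs⟩ := exists_ne (0 : M)
  obtain ⟨i, hi⟩ : ∃ i : V, π.ofPath (Quiver.Path.nil : Quiver.Path i i) • s ≠ 0 := by
    by_contra! h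
    refine hs ?_
    rw [← one_smul A s, ← map_one π.toAlgHom, one_eq_sum, map_sum, Finset.sum_smul]
    exact Finset.sum_eq_zero fun i _ => h i
  -- A longest path that does not kill `s` moves it into the socle.
  let S : Set (QuiverPath V) := {q | π.ofPath q.path • s ≠ 0}
  have hb : BddAbove ((fun q : QuiverPath V => q.path.length) '' S) := by
    refine ⟨π.bound, ?_⟩
    rintro _ ⟨q, hq, rfl⟩
    refine (π.length_lt_bound (p := q.path) fun h => hq ?_).le
    rw [h, zero_smul]
  obtain ⟨q, hq, hmax⟩ := Nat.sSup_mem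
    (show (_ '' S).Nonempty from ⟨_, ⟨i, i, .nil⟩, hi, rfl⟩) hb
  refine ⟨q.tgt, π.ofPath q.path • s, hq, ?_, fun {j} e => ?_⟩
  · rw [← mul_smul, ofPath_mul_ofPath, Quiver.Path.comp_nil]
  · by_contra hne
    rw [← mul_smul, ofPath_mul_ofPath] at hne
    have := le_csSup hb ⟨⟨_, _, q.path.comp e.toPath⟩, hne, rfl⟩
    rw [← hmax] at this
    simp at this

end Socle

/-! ### Maximal paths. -/

/-- A nonzero path that cannot be prolonged to a longer nonzero path. -/
structure IsMaximalPath {a b : V} (p : Quiver.Path a b) : Prop where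
  ne_zero : π.ofPath p ≠ 0
  cons_eq_zero : ∀ {c : V} (e : b ⟶ c), π.ofPath (p.cons e) = 0

variable {π}

theorem IsMaximalPath.isSocleAt {a b : V} {p : Quiver.Path a b} (hp : π.IsMaximalPath p) :
    π.IsSocleAt b (π.ofPath p) where
  nil_smul := by rw [smul_eq_mul, ofPath_mul_ofPath, Quiver.Path.comp_nil]
  arrow_smul e := by
    rw [smul_eq_mul, ofPath_mul_ofPath, Quiver.Path.comp_toPath_eq_cons, hp.cons_eq_zero]

variable (π) in
theorem exists_isMaximalPath_comp {a b : V} (p : Quiver.Path a b) (hp : π.ofPath p ≠ 0) :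
    ∃ (c : V) (r : Quiver.Path b c), π.IsMaximalPath (p.comp r) := by
  by_cases h : ∃ (c : V) (e : b ⟶ c), π.ofPath (p.cons e) ≠ 0
  · obtain ⟨c, e, he⟩ := h
    have hlt := π.length_lt_bound he
    obtain ⟨d, r, hr⟩ := exists_isMaximalPath_comp (p.cons e) he
    exact ⟨d, e.toPath.comp r, by
      rwa [← Quiver.Path.comp_assoc, Quiver.Path.comp_toPath_eq_cons]⟩
  · push Not at h
    exact ⟨b, .nil, hp, h _⟩
termination_by π.bound - p.length
decreasing_by
  simp only [Quiver.Path.length_cons] at *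
  omega

theorem IsMaximalPath.smul_eq {a b : V} {p : Quiver.Path a b} (hp : π.IsMaximalPath p) (x) :
    π.toAlgHom x * π.ofPath p = coeff ⟨b, b, .nil⟩ x • π.ofPath p :=
  hp.isSocleAt.smul_eq x

theorem exists_map_eq_of_isSocleAt {A : Type u} [Ring A] [Algebra K A]
    {π : MonomialPresentation K V A} {M N : Type u} [AddCommGroup M] [Module A M]
    [AddCommGroup N] [Module A N] (hM : Module.Injective A M) {i : V} {s : N} {t : M} (hs : s ≠ 0)
    (his : π.IsSocleAt i s) (hit : π.IsSocleAt i t) : ∃ f : N →ₗ[A] M, f s = t := by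
  let _ : Module K N := Module.compHom N (algebraMap K A)
  let _ : Module K M := Module.compHom M (algebraMap K A)
  have : IsScalarTower K A N := ⟨fun c a n => by
    rw [Algebra.smul_def, mul_smul]; rfl⟩
  have : IsScalarTower K A M := ⟨fun c a n => by
    rw [Algebra.smul_def, mul_smul]; rfl⟩
  refine hM.exists_map_eq s t fun a ha => ?_
  obtain ⟨x, rfl⟩ := π.surjective a
  rw [his.smul_eq] at ha
  rw [hit.smul_eq, (smul_eq_zero.1 ha).resolve_right hs, zero_smul]

theorem linearMap_eq_mul {A : Type*} [Ring A] (f : A →ₗ[A] A) (a : A) : f a = a * f 1 := by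
  rw [← smul_eq_mul, ← map_smul, smul_eq_mul, mul_one]

variable {a b c d : V}

/-- The nonzero path `q` occurs in every lift of its image, while only paths ending with `p` occur
in a lift `p * x`. -/
theorem length_le_of_mul_eq {p : Quiver.Path a b} {q : Quiver.Path c d} (hq : π.ofPath q ≠ 0)
    {y : A} (h : π.ofPath p * y = π.ofPath q) : p.length ≤ q.length ∧
      (q.length ≤ p.length → (⟨c, d, q⟩ : QuiverPath V) = ⟨a, b, p⟩) := by
  obtain ⟨x, rfl⟩ := π.surjective y
  refine coeff_of_mul (K := K) p x ⟨c, d, q⟩ ?_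
  rw [π.coeff_eq_coeff (y := of K ⟨c, d, q⟩) (by rw [map_mul]; exact h) hq]
  simp

/-- Both paths are socle elements at one vertex, so right multiplications carry each to the other;
comparing lengths both ways forces equality. -/
theorem IsMaximalPath.eq_of_tgt_eq (hA : Module.Injective A A) {p : Quiver.Path a b}
    {q : Quiver.Path c d} (hp : π.IsMaximalPath p) (hq : π.IsMaximalPath q) (h : b = d) :
    (⟨a, b, p⟩ : QuiverPath V) = ⟨c, d, q⟩ := by
  subst h
  obtain ⟨f, hf⟩ := exists_map_eq_of_isSocleAt hA hp.ne_zero hp.isSocleAt hq.isSocleAt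
  obtain ⟨g, hg⟩ := exists_map_eq_of_isSocleAt hA hq.ne_zero hq.isSocleAt hp.isSocleAt
  rw [linearMap_eq_mul] at hf hg
  exact (length_le_of_mul_eq hp.ne_zero hg).2 (length_le_of_mul_eq hq.ne_zero hf).1

/-- If distinct, the paths span independent lines that are left ideals, so some right multiplication
by `y` fixes `p` and kills `q`. The coefficient of `y` at the stationary path of `a` would then be
both 1 and 0. -/
theorem IsMaximalPath.eq_of_src_eq (hA : Module.Injective A A) {p : Quiver.Path a b}
    {q : Quiver.Path a c} (hp : π.IsMaximalPath p) (hq : π.IsMaximalPath q) :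
    (⟨a, b, p⟩ : QuiverPath V) = ⟨a, c, q⟩ := by
  by_contra hne
  have hdisj : Disjoint (Submodule.span A {π.ofPath p}) (Submodule.span A {π.ofPath q}) := by
    rw [Submodule.disjoint_def]
    intro z hz hz'
    obtain ⟨x, rfl⟩ := Submodule.mem_span_singleton.1 hz
    obtain ⟨y, hy⟩ := Submodule.mem_span_singleton.1 hz'
    obtain ⟨x, rfl⟩ := π.surjective x
    obtain ⟨y, rfl⟩ := π.surjective y
    rw [smul_eq_mul, smul_eq_mul, hp.smul_eq, hq.smul_eq] at hy
    rw [smul_eq_mul, hp.smul_eq]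
    unfold ofPath at hy
    rw [← map_smul, ← map_smul] at hy
    have := π.coeff_eq_coeff hy hp.ne_zero
    rw [map_smul, map_smul, coeff_of_self, coeff_of_ne (Ne.symm hne), smul_zero, smul_eq_mul,
      mul_one] at this
    rw [← this, zero_smul]
  obtain ⟨f, hf, hf'⟩ := hA.exists_projection hdisj
  have h1 := hf _ (Submodule.mem_span_singleton_self _)
  have h2 := hf' _ (Submodule.mem_span_singleton_self _)
  rw [linearMap_eq_mul] at h1 h2
  obtain ⟨y, hy⟩ := π.surjective (f 1)
  rw [← hy, ofPath, ← map_mul] at h1 h2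
  have h1' := π.coeff_eq_coeff h1 hp.ne_zero
  have h2' := π.coeff_eq_coeff (h2.trans (map_zero π.toAlgHom).symm) hq.ne_zero
  rw [coeff_self_of_mul] at h1' h2'
  simp [h1'] at h2'

/-- Both paths prolong to the same maximal path. -/
theorem exists_eq_comp (hA : Module.Injective A A) (p : Quiver.Path a b) (q : Quiver.Path a c)
    (hp : π.ofPath p ≠ 0) (hq : π.ofPath q ≠ 0) (hle : p.length ≤ q.length) :
    ∃ t : Quiver.Path b c, q = p.comp t := by
  obtain ⟨d, r, hr⟩ := π.exists_isMaximalPath_comp p hp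
  obtain ⟨d', r', hr'⟩ := π.exists_isMaximalPath_comp q hq
  have h := hr.eq_of_src_eq hA hr'
  obtain rfl : d = d' := congr(($h).tgt)
  exact Quiver.Path.exists_eq_comp_of_comp_eq_comp p r q r' (by simpa using h) hle

/-- Choosing a maximal path from each vertex gives an injective target map on a finite set, hence a
surjective one. -/
theorem exists_isMaximalPath_of_tgt (hA : Module.Injective A A) (i : V) :
    ∃ (j : V) (p : Quiver.Path j i), π.IsMaximalPath p := by
  choose t m hm using fun j : V => π.exists_isMaximalPath_comp _ (π.map_nil_ne_zero j)
  have hinj : Function.Injective t := fun j k hjk =>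
    congr(($((hm j).eq_of_tgt_eq hA (hm k) hjk)).src)
  obtain ⟨j, rfl⟩ := (Finite.injective_iff_surjective.1 hinj) i
  exact ⟨j, _, hm j⟩

/-! ### Uniseriality of `A e_i` and of indecomposable injectives. -/

theorem exists_coeff_ne_zero_imp (x : A) (i : V) : ∃ y : PathAlgebra K V,
    π.toAlgHom y = x * π.ofPath (Quiver.Path.nil : Quiver.Path i i) ∧
      ∀ q, coeff q y ≠ 0 → q.src = i ∧ π.ofPath q.path ≠ 0 := by
  classical
  obtain ⟨x, rfl⟩ := π.surjective x
  let F : PathAlgebra K V →ₗ[K] PathAlgebra K V :=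
    lift K fun q => if q.src = i ∧ π.ofPath q.path ≠ 0 then of K q else 0
  have hF (q : QuiverPath V) : F (of K q) =
      if q.src = i ∧ π.ofPath q.path ≠ 0 then of K q else 0 := lift_of _ q
  refine ⟨F x, ?_, fun q hq => ?_⟩
  · refine mem_of_coeff (LinearMap.eqLocus (π.toAlgHom.toLinearMap ∘ₗ F)
      (LinearMap.mulRight K (π.ofPath (Quiver.Path.nil : Quiver.Path i i)) ∘ₗ
        π.toAlgHom.toLinearMap)) x fun q _ => ?_
    change π.toAlgHom (F (of K q)) = π.ofPath q.path * π.ofPath .nil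
    rw [hF]
    split_ifs with h
    · obtain ⟨rfl, -⟩ := h
      rw [ofPath_mul_ofPath, Quiver.Path.nil_comp, ofPath]
    · rw [map_zero]
      by_cases hi : q.src = i
      · rw [not_not.1 fun h0 => h ⟨hi, h0⟩, zero_mul]
      · rw [π.ofPath_mul_ofPath_of_ne _ _ (Ne.symm hi)]
  · by_contra h
    refine hq (mem_of_coeff (LinearMap.ker (coeff q ∘ₗ F)) x fun p _ => ?_)
    change coeff q (F (of K p)) = 0
    rw [hF]
    split_ifs with hp
    · exact coeff_of_ne fun hpq => h (hpq ▸ hp)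
    · exact map_zero _

/-- The shortest path `p` in a reduced lift of `x` is an initial segment of all the others.
Factoring it out leaves a nonzero scalar plus a nilpotent element, which is a unit. -/
theorem exists_isUnit_mul_eq (hA : Module.Injective A A) {x : A} (hx : x ≠ 0) {i : V}
    (hxi : x * π.ofPath (Quiver.Path.nil : Quiver.Path i i) = x) :
    ∃ (u : A) (j : V) (p : Quiver.Path i j), IsUnit u ∧ π.ofPath p ≠ 0 ∧ x = u * π.ofPath p := by
  obtain ⟨y, hy, hcoeff⟩ := π.exists_coeff_ne_zero_imp x i
  rw [hxi] at hy
  obtain ⟨⟨i', j, p⟩, hp, hmin⟩ := exists_min_length (x := y) (by rintro rfl; simp [← hy] at hx)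
  obtain ⟨rfl, hp0⟩ := hcoeff _ hp
  dsimp only at *
  let S : Submodule K (PathAlgebra K V) :=
    { carrier := {z | ∃ w, z = w * of K ⟨i', j, p⟩ ∧ ∀ q, coeff q w ≠ 0 → 0 < q.path.length}
      zero_mem' := ⟨0, by simp⟩
      add_mem' := by
        rintro _ _ ⟨w, rfl, hw⟩ ⟨w', rfl, hw'⟩
        refine ⟨w + w', by rw [add_mul], fun q hq => ?_⟩
        by_contra h
        exact hq (by
          rw [map_add, not_not.1 (mt (hw q) h), not_not.1 (mt (hw' q) h), add_zero])
      smul_mem' := by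
        rintro c _ ⟨w, rfl, hw⟩
        refine ⟨c • w, by rw [smul_mul_assoc], fun q hq => hw q fun h => hq ?_⟩
        rw [map_smul, h, smul_zero] }
  have hmem : y - coeff ⟨i', j, p⟩ y • of K ⟨i', j, p⟩ ∈ S := by
    refine mem_of_coeff S _ fun q hq => ?_
    have hqp : q ≠ ⟨i', j, p⟩ := by
      rintro rfl
      simp at hq
    rw [map_sub, map_smul, coeff_of_ne hqp.symm, smul_zero, sub_zero] at hq
    obtain ⟨a, b, q⟩ := q
    obtain ⟨ha, hq0⟩ := hcoeff _ hq
    dsimp only at ha hq0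
    subst ha
    obtain ⟨t, rfl⟩ := exists_eq_comp hA p q hp0 hq0 (hmin _ hq)
    refine ⟨of K ⟨j, b, t⟩, (of_mul_of_comp p t).symm, fun q hq => ?_⟩
    have : ⟨j, b, t⟩ = q := by_contra fun h => hq (coeff_of_ne h)
    subst this
    -- A stationary `t` would mean that the path is `p` itself, whose term has been subtracted.
    cases t with
    | nil => exact absurd rfl hqp
    | cons t e => simp
  obtain ⟨w, hw, hpos⟩ := hmem
  refine ⟨_, j, p, π.isUnit hp hpos, hp0, ?_⟩
  rw [add_mul, ofPath, ← map_mul, ← hw, map_sub, map_smul, hy, Algebra.smul_def,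
    add_sub_cancel]

theorem exists_mul_eq_or (hA : Module.Injective A A) {i : V} {x y : A}
    (hx : x * π.ofPath (Quiver.Path.nil : Quiver.Path i i) = x)
    (hy : y * π.ofPath (Quiver.Path.nil : Quiver.Path i i) = y) :
    (∃ c, x = c * y) ∨ ∃ c, y = c * x := by
  rcases eq_or_ne x 0 with rfl | hx0
  · exact .inl ⟨0, by simp⟩
  rcases eq_or_ne y 0 with rfl | hy0
  · exact .inr ⟨0, by simp⟩
  obtain ⟨_, j, p, ⟨u, rfl⟩, hp, rfl⟩ := π.exists_isUnit_mul_eq hA hx0 hx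
  obtain ⟨_, k, q, ⟨v, rfl⟩, hq, rfl⟩ := π.exists_isUnit_mul_eq hA hy0 hy
  rcases le_total p.length q.length with h | h
  · obtain ⟨t, rfl⟩ := exists_eq_comp hA p q hp hq h
    exact .inr ⟨v * π.ofPath t * ↑u⁻¹, by simp [mul_assoc, ofPath_mul_ofPath]⟩
  · obtain ⟨t, rfl⟩ := exists_eq_comp hA q p hq hp h
    exact .inl ⟨u * π.ofPath t * ↑v⁻¹, by simp [mul_assoc, ofPath_mul_ofPath]⟩

/-- A socle element `s` of `E` is matched with a maximal path `p` ending at its vertex; the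
resulting map from `E` to `A e_j` is injective because `E` is uniform. -/
theorem isUniserialModule {A : Type u} [Ring A] [Algebra K A] [IsArtinianRing A]
    (π : MonomialPresentation K V A) (hA : Module.Injective A A) {E : Type u} [AddCommGroup E]
    [Module A E] [Module.Finite A E] (hind : IsIndecomposableModule A E)
    (hE : Module.Injective A E) : IsUniserialModule A E := by
  have := hind.1
  obtain ⟨i, s, hs0, hs⟩ := π.exists_isSocleAt (M := E)
  obtain ⟨j, p, hp⟩ := exists_isMaximalPath_of_tgt (π := π) hA i
  obtain ⟨f, hf⟩ := exists_map_eq_of_isSocleAt hA hs0 hs hp.isSocleAt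
  obtain ⟨h, hh⟩ := exists_map_eq_of_isSocleAt hE hp.ne_zero hp.isSocleAt hs
  let e : A := π.ofPath (Quiver.Path.nil : Quiver.Path j j)
  have he : e * e = e := by simp [e, ofPath_mul_ofPath]
  -- Right multiplication by `e` forces the values into `A e` and fixes `p`, which starts at `j`.
  let g : E →ₗ[A] A := LinearMap.toSpanSingleton A A e ∘ₗ f
  have hg (x : E) : g x * e = g x := by simp [g, mul_assoc, he]
  have hgs : g s = π.ofPath p := by simp [g, hf, e, ofPath_mul_ofPath]
  have hdisj : Disjoint (Submodule.span A {s}) (LinearMap.ker g) := by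
    rw [Submodule.disjoint_def]
    intro z hz hz'
    obtain ⟨a, rfl⟩ := Submodule.mem_span_singleton.1 hz
    rw [LinearMap.mem_ker, map_smul, hgs] at hz'
    -- `h` carries `p` back to `s`, so whatever kills `p` kills `s`.
    rw [← hh, ← map_smul, hz', map_zero]
  have hker : LinearMap.ker g = ⊥ :=
    (hind.eq_bot_or_eq_bot hE hdisj).resolve_left (by simpa using hs0)
  have hinj := LinearMap.ker_eq_bot.1 hker
  intro N P
  by_contra! hNP
  obtain ⟨x, hxN, hxP⟩ := Set.not_subset.1 hNP.1
  obtain ⟨y, hyP, hyN⟩ := Set.not_subset.1 hNP.2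
  rcases π.exists_mul_eq_or hA (hg x) (hg y) with ⟨c, hc⟩ | ⟨c, hc⟩
  · rw [← smul_eq_mul, ← map_smul] at hc
    exact hxP (hinj hc ▸ P.smul_mem c hyP)
  · rw [← smul_eq_mul, ← map_smul] at hc
    exact hyN (hinj hc ▸ N.smul_mem c hxN)

end MonomialPresentation

theorem corollary1p2 {K : Type*} [Field K] [IsAlgClosed K] {A : Type*} [Ring A] [Algebra K A]
    [FiniteDimensional K A] (hmon : IsMonomialAlgebra K A) (hinj : IsSelfInjective A) :
    IsNakayamaAlgebra A := by
  obtain ⟨V, _, _, ⟨π⟩⟩ := hmon.exists_presentation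
  have : IsArtinianRing A := IsArtinianRing.of_finite K A
  have hA : Module.Injective A A := hinj
  exact ⟨fun P _ _ _ hind _ => π.isUniserialModule hA hind .of_projective,
    fun E _ _ _ hind hE => π.isUniserialModule hA hind hE⟩

end
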